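/- Let $G$ be a countably infinite locally finite abelian group (every finitely generated subgroup is finite), regarded as a discrete group, with Pontryagin dual $\widehat G$ (a compact group), and let $\lambda$ be the Haar measure on $\widehat G$ with $\lambda(\widehat G)=1$. Let $2<p<\infty$, and let $\ell^pG$ be the space of $p$-summable functions $G\to\mathbb C$, on which $G$ acts by translation, $(g\cdot f)(h)=f(g^{-1}h)$. Let $\mu$ be a finite (positive) Borel measure on $\widehat G$ whose support $\operatorname{supp}\mu=\{\chi : \mu(V)>0 \text{ for every open } V\ni\chi\}$ satisfies $\lambda(\operatorname{supp}\mu)=0$, and whose Fourier–Stieltjes transform $\widehat\mu(g)=\int_{\widehat G}\overline{\chi(g)}\,d\mu(\chi)$ lies in $\ell^pG$. Let $F$ be the smallest closed $G$-invariant linear subspace of $\ell^pG$ containing $\widehat\mu$. Then there is an invariant exhaustion $(E_i)_{i\in\mathbb N}$ of $\ell^pG$, i.e. a sequence of closed $G$-invariant linear subspaces $E_0\subseteq E_1\subseteq\cdots$ of $\ell^pG$ with dense union, such that $F\cap E_i=0$ for all $i\in\mathbb N$. Moreover, the $E_i$ can be chosen in the form $E_i=\{x\in\ell^pG : \widehat{\sigma_i}*x=x\}$,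 where the $\sigma_i:\widehat G\to\mathbb C$ are locally constant functions such that each $\sigma_i$ vanishes on a neighbourhood of $\operatorname{supp}\mu$, for each $\chi\notin\operatorname{supp}\mu$ one has $\sigma_i(\chi)=1$ for all sufficiently large $i$, and each Fourier transform $\widehat{\sigma_i}(g)=\int_{\widehat G}\sigma_i(\chi)\overline{\chi(g)}\,d\lambda(\chi)$ is finitely supported on $G$. Here $(S*x)(g)=\sum_{h\in G}S(h)\,x(h^{-1}g)$. -/

import Mathlib

open scoped ENNReal Topology ComplexConjugate

namespace LpExhaustion

noncomputable section

/-- A group is locally finite if each of its finitely generated subgroups is finite. -/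
def LocallyFiniteGroup (G : Type*) [Group G] : Prop :=
  ∀ H : Subgroup G, H.FG → Finite H

/-- The complex Banach space `ℓ^p G`. -/
abbrev EllP (G : Type*) (p : ℝ≥0∞) := lp (fun _ : G => ℂ) p

theorem memEllP_comp_equiv {G : Type*} {p : ℝ≥0∞} (e : G ≃ G) {f : G → ℂ}
    (hf : Memℓp f p) : Memℓp (fun h => f (e h)) p := by
  rcases p.trichotomy with (rfl | rfl | hp)
  · refine memℓp_zero ?_
    exact (memℓp_zero_iff.1 hf).preimage (e.injective.injOn)
  · refine memℓp_infty ?_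
    refine (memℓp_infty_iff.1 hf).mono ?_
    rintro _ ⟨h, rfl⟩
    exact ⟨e h, rfl⟩
  · refine (memℓp_gen_iff hp).2 ?_
    exact ((memℓp_gen_iff hp).1 hf).comp_injective e.injective

/-- Left translation on `ℓ^p G`: `(g • f)(h) = f (g⁻¹ h)`. -/
def translate {G : Type*} [Group G] {p : ℝ≥0∞} (g : G) (f : EllP G p) : EllP G p :=
  ⟨fun h => f (g⁻¹ * h), memEllP_comp_equiv (Equiv.mulLeft g⁻¹) (lp.memℓp f)⟩

section Invariant

variable {G : Type*} [Group G] {p : ℝ≥0∞} [Fact (1 ≤ p)]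

/-- Closed (left-)`G`-invariant linear subspaces of `ℓ^p G`. -/
structure IsClosedInvariant (E : Submodule ℂ (EllP G p)) : Prop where
  isClosed : IsClosed (E : Set (EllP G p))
  invariant : ∀ (g : G), ∀ f ∈ E, translate g f ∈ E

/-- The closed invariant subspace generated by `f`: the smallest one containing `f`. -/
def closedInvariantSpan (f : EllP G p) : Submodule ℂ (EllP G p) :=
  sInf {E | IsClosedInvariant E ∧ f ∈ E}

/-- An invariant exhaustion of `ℓ^p G`: an increasing sequence of closed invariant subspaces
whose union is dense. -/
structure IsInvariantExhaustion (E : ℕ → Submodule ℂ (EllP G p)) : Prop where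
  closedInvariant : ∀ i, IsClosedInvariant (E i)
  monotone : Monotone E
  dense : Dense (⋃ i, (E i : Set (EllP G p)))

end Invariant

/-- Convolution of functions on `G`, `(S * x)(g) = ∑ h, S h * x (h⁻¹ g)`. It is used only for
finitely supported `S`, so that the sum is finite. -/
def convolve {G : Type*} [Group G] (S x : G → ℂ) (g : G) : ℂ :=
  ∑' h, S h * x (h⁻¹ * g)

section Dual

variable {G : Type*} [CommGroup G] [TopologicalSpace G] [DiscreteTopology G]
  [MeasurableSpace (PontryaginDual G)] [BorelSpace (PontryaginDual G)]

/-- The Haar measure of total mass `1` on the compact group dual to the discrete group `G`. -/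
def dualHaar (G : Type*) [CommGroup G] [TopologicalSpace G] [DiscreteTopology G]
    [MeasurableSpace (PontryaginDual G)] [BorelSpace (PontryaginDual G)] :
    MeasureTheory.Measure (PontryaginDual G) :=
  MeasureTheory.Measure.haarMeasure ⊤

/-- The Fourier–Stieltjes transform `μ̂(g) = ∫ conj (χ g) dμ(χ)` of a finite measure on the dual
group. -/
def fourierStieltjes (μ : MeasureTheory.Measure (PontryaginDual G)) (g : G) : ℂ :=
  ∫ χ, conj ((χ g : Circle) : ℂ) ∂μ

/-- The Fourier transform `σ̂(g) = ∫ σ(χ) conj (χ g) dλ(χ)` of a function on the dual group, with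
respect to the normalized Haar measure. -/
def fourierTransform (σ : PontryaginDual G → ℂ) (g : G) : ℂ :=
  ∫ χ, σ χ * conj ((χ g : Circle) : ℂ) ∂(dualHaar G)

end Dual

end

end LpExhaustion

/-! Write `K = supp μ` and exhaust `G` by finite subgroups `H n`. Let `U n` be the set of characters
agreeing on `H n` with some element of `K`. It is clopen, and by compactness the `U n` decrease to
`K`, so `λ(U n) → λ(K) = 0`. Take `σ n = 1 - 1_{U n}`, whose transform lives on `H n`, let `C n` be
convolution with that transform, and let `E n` be the fixed space of `C n`.

Multiplicative identities among the `σ n` become operator identities. From `σ n * σ m = σ m` for `m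
≤ n` follows `C n ∘ C m = C m`, so the `E n` increase and contain the ranges of the `C n`. Since `σ
n = 0` on `K`, `C n` kills `μ̂`, hence all of `F`; a vector of `F ∩ E n` is therefore both killed
and fixed by `C n`.

Density is where `p ≥ 2` enters: `δ₁ - C n δ₁` is the transform of `1_{U n}`, with values of modulus
at most one, so by Parseval `‖δ₁ - C n δ₁‖_p^p ≤ λ(U n) → 0` (`norm_single_sub_convolveCLM_le`).
Equivariance passes this to every point mass. -/

namespace LpExhaustion

open MeasureTheory

/-! ### Characters of `G`: local constancy on finite subgroups, separation of points. -/

section Characters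

/-- The injective character `q ↦ exp (2πiq)` of `ℚ / ℤ`. -/
noncomputable def ratCircleHom : AddCircle (1 : ℚ) →+ Additive Circle :=
  QuotientAddGroup.lift _
    (Circle.expHom.comp ((AddMonoidHom.mulLeft (2 * Real.pi)).comp (Rat.castHom ℝ).toAddMonoidHom)) <| by
      intro x hx
      obtain ⟨n, rfl⟩ := AddSubgroup.mem_zmultiples_iff.1 hx
      refine AddSubgroup.zsmul_mem _ ?_ n
      rw [AddMonoidHom.mem_ker]
      change Additive.ofMul (Circle.exp (2 * Real.pi * ((1 : ℚ) : ℝ))) = 0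
      simp

theorem ratCircleHom_eq_zero {x : AddCircle (1 : ℚ)} (hx : ratCircleHom x = 0) : x = 0 := by
  induction x using QuotientAddGroup.induction_on with
  | H q =>
    have h1 : Circle.exp (2 * Real.pi * (q : ℝ)) = 1 := hx
    obtain ⟨n, hn⟩ := Circle.exp_eq_one.1 h1
    have h2 : (q : ℝ) = n := by
      have := Real.pi_pos
      have h3 : 2 * Real.pi * ((q : ℝ) - n) = 0 := by linarith
      rcases mul_eq_zero.1 h3 with h | h <;> linarith
    rw [QuotientAddGroup.eq_zero_iff]
    refine AddSubgroup.mem_zmultiples_iff.2 ⟨n, ?_⟩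
    have h4 : q = n := by exact_mod_cast h2
    simp [h4]

variable {G : Type*} [CommGroup G] [TopologicalSpace G]

theorem dual_mul_apply (χ ψ : PontryaginDual G) (g : G) : (χ * ψ) g = χ g * ψ g := rfl

theorem dual_inv_apply (χ : PontryaginDual G) (g : G) : χ⁻¹ g = (χ g)⁻¹ := rfl

/-- A function on the dual that only depends on the restriction of characters to `H`. -/
def FactorsThroughRestrict (H : Subgroup G) (σ : PontryaginDual G → ℂ) : Prop :=
  ∀ χ ψ : PontryaginDual G, (∀ h ∈ H, χ h = ψ h) → σ χ = σ ψ

/-- The sum of a character over a finite subgroup vanishes unless the character is trivial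
on it. -/
theorem sum_dual_apply_eq_zero (H : Subgroup G) [Fintype H] {χ : PontryaginDual G}
    (hχ : ∃ h : H, χ (h : G) ≠ 1) : ∑ h : H, ((χ (h : G) : Circle) : ℂ) = 0 := by
  let f : H →* ℂ := Circle.coeHom.comp ((χ : G →* Circle).comp H.subtype)
  refine sum_hom_units_eq_zero f fun h => ?_
  obtain ⟨x, hx⟩ := hχ
  exact hx (Circle.ext (DFunLike.congr_fun h x))

theorem continuous_dual_apply (g : G) : Continuous fun χ : PontryaginDual G => χ g :=
  have h : Continuous fun f : C(G, Circle) => f g := continuous_eval_const g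
  h.comp (ContinuousMonoidHom.isInducing_toContinuousMap G Circle).continuous

theorem continuous_dual_apply_coe (g : G) :
    Continuous fun χ : PontryaginDual G => ((χ g : Circle) : ℂ) :=
  continuous_subtype_val.comp (continuous_dual_apply g)

theorem finite_circle_pow_eq_one {m : ℕ} (hm : 0 < m) : {z : Circle | z ^ m = 1}.Finite := by
  refine Set.Finite.of_finite_image (f := ((↑) : Circle → ℂ)) ?_ Circle.coe_injective.injOn
  refine (Polynomial.nthRootsFinset m (1 : ℂ)).finite_toSet.subset ?_
  rintro _ ⟨z, hz, rfl⟩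
  rw [Finset.mem_coe, Polynomial.mem_nthRootsFinset hm]
  exact_mod_cast congrArg ((↑) : Circle → ℂ) hz

/-- Evaluation of characters at an element of finite order is locally constant. -/
theorem isLocallyConstant_dual_apply {g : G} (hg : IsOfFinOrder g) :
    IsLocallyConstant fun χ : PontryaginDual G => χ g := by
  refine (IsLocallyConstant.iff_exists_open _).2 fun χ => ?_
  -- Every `ψ g` is an `orderOf g`-th root of unity, so avoiding the finitely many roots other than
  -- `χ g` forces `ψ g = χ g`.
  refine ⟨(fun ψ : PontryaginDual G => ψ g) ⁻¹' ({z | z ^ orderOf g = 1} \ {χ g})ᶜ,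
    ?_, by simp, fun ψ hψ => ?_⟩
  · exact ((finite_circle_pow_eq_one hg.orderOf_pos).sdiff).isClosed.isOpen_compl.preimage
      (continuous_dual_apply g)
  · by_contra h
    refine hψ ⟨?_, h⟩
    change ψ g ^ orderOf g = 1
    rw [← map_pow, pow_orderOf_eq_one, map_one]

theorem isLocallyConstant_dual_restrict (H : Subgroup G) [Finite H] :
    IsLocallyConstant fun (χ : PontryaginDual G) (h : H) => χ (h : G) := by
  refine (IsLocallyConstant.iff_eventually_eq _).2 fun χ => ?_
  have : ∀ h : H, ∀ᶠ ψ : PontryaginDual G in 𝓝 χ, ψ (h : G) = χ (h : G) := fun h =>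
    (isLocallyConstant_dual_apply (H.subtype.isOfFinOrder (isOfFinOrder_of_finite h))).eventually_eq
      χ
  filter_upwards [Filter.eventually_all.2 this] with ψ hψ
  exact funext hψ

/-- Restriction of characters to a finite subgroup, as a locally constant function. -/
noncomputable def dualRestrict (H : Subgroup G) [Finite H] : LocallyConstant (PontryaginDual G) (H → Circle) :=
  ⟨fun χ h => χ (h : G), isLocallyConstant_dual_restrict H⟩

variable [DiscreteTopology G]

/-- The characters of a discrete abelian group separate its points. -/
theorem exists_dual_apply_ne_one {g : G} (hg : g ≠ 1) :
    ∃ χ : PontryaginDual G, χ g ≠ 1 := by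
  obtain ⟨c, hc⟩ := CharacterModule.exists_character_apply_ne_zero_of_ne_zero
    (A := Additive G) (a := Additive.ofMul g) hg
  let f : G →* Circle := AddMonoidHom.toMultiplicative (ratCircleHom.comp c)
  refine ⟨(⟨f, continuous_of_discreteTopology⟩ : G →ₜ* Circle), fun h => hc ?_⟩
  exact ratCircleHom_eq_zero h

end Characters

/-! ### Fourier analysis of functions factoring through restriction to a finite subgroup. -/

section Fourier

variable {G : Type*} [CommGroup G] [TopologicalSpace G] [DiscreteTopology G]
  [MeasurableSpace (PontryaginDual G)] [BorelSpace (PontryaginDual G)]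

instance : IsProbabilityMeasure (dualHaar G) :=
  ⟨by simpa [dualHaar] using Measure.haarMeasure_self (K₀ := (⊤ : TopologicalSpace.PositiveCompacts
    (PontryaginDual G)))⟩

instance : (dualHaar G).IsMulLeftInvariant := by
  unfold dualHaar; infer_instance

theorem integrable_of_continuous_dual (ν : Measure (PontryaginDual G)) [IsFiniteMeasure ν]
    {f : PontryaginDual G → ℂ} (hf : Continuous f) : Integrable f ν :=
  hf.integrable_of_hasCompactSupport (HasCompactSupport.of_compactSpace f)

/-- Translating by a character `ψ` with `ψ g ≠ 1` multiplies the integral by `conj (ψ g) ≠ 1`, yet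
leaves it unchanged. -/
theorem integral_dual_apply {g : G} (hg : g ≠ 1) :
    ∫ χ : PontryaginDual G, conj ((χ g : Circle) : ℂ) ∂(dualHaar G) = 0 := by
  obtain ⟨ψ, hψ⟩ := exists_dual_apply_ne_one hg
  have h := integral_mul_left_eq_self (μ := dualHaar G)
    (fun χ : PontryaginDual G => conj ((χ g : Circle) : ℂ)) ψ
  simp only [dual_mul_apply, Circle.coe_mul, map_mul] at h
  rw [integral_const_mul] at h
  by_contra h0
  have h1 : conj ((ψ g : Circle) : ℂ) = 1 := (mul_eq_right₀ h0).1 h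
  refine hψ (Circle.ext ?_)
  rw [Circle.coe_one, ← Complex.conj_conj ((ψ g : Circle) : ℂ), h1, map_one]

variable {H : Subgroup G}

/-- Fourier inversion for functions that factor through the restriction to a finite subgroup. -/
theorem FactorsThroughRestrict.inversion [Fintype H] {σ : PontryaginDual G → ℂ}
    (hσ : FactorsThroughRestrict H σ) (hc : Continuous σ) (χ : PontryaginDual G) :
    ∑ h : H, fourierTransform σ (h : G) * ((χ (h : G) : Circle) : ℂ) = σ χ := by
  -- Needed twice: for `σ`, and for the constant `1`, to evaluate the integral of the kernel.
  have key : ∀ τ : PontryaginDual G → ℂ, Continuous τ →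
      ∑ h : H, fourierTransform τ (h : G) * ((χ (h : G) : Circle) : ℂ) =
        ∫ ψ, τ ψ * ∑ h : H, (((χ * ψ⁻¹) (h : G) : Circle) : ℂ) ∂(dualHaar G) := by
    intro τ hτ
    simp_rw [Finset.mul_sum]
    rw [integral_finsetSum]
    · refine Finset.sum_congr rfl fun h _ => ?_
      rw [fourierTransform, ← integral_mul_const]
      refine integral_congr_ae (Filter.Eventually.of_forall fun ψ => ?_)
      simp only [dual_mul_apply, dual_inv_apply, Circle.coe_mul, Circle.coe_inv_eq_conj]
      ring
    · intro h _
      refine integrable_of_continuous_dual _ (hτ.mul ?_)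
      simp only [dual_mul_apply, dual_inv_apply, Circle.coe_mul, Circle.coe_inv_eq_conj]
      exact continuous_const.mul (Complex.continuous_conj.comp (continuous_dual_apply_coe _))
  -- The kernel vanishes unless `χ` and `ψ` agree on `H`, in which case `σ ψ = σ χ`.
  have h1 : ∀ ψ : PontryaginDual G, σ ψ * ∑ h : H, (((χ * ψ⁻¹) (h : G) : Circle) : ℂ) =
      σ χ * ((1 : ℂ) * ∑ h : H, (((χ * ψ⁻¹) (h : G) : Circle) : ℂ)) := by
    intro ψ
    by_cases h : ∃ h : H, (χ * ψ⁻¹) (h : G) ≠ 1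
    · rw [sum_dual_apply_eq_zero H h]; simp
    · push Not at h
      rw [hσ ψ χ fun g hg => (mul_inv_eq_one.1 (h ⟨g, hg⟩)).symm, one_mul]
  rw [key σ hc]
  simp_rw [h1]
  rw [integral_const_mul, ← key (fun _ => 1) continuous_const]
  rw [Finset.sum_eq_single (1 : H)]
  · simp [fourierTransform]
  · intro h _ hh
    have : (h : G) ≠ 1 := by simpa using hh
    simp [fourierTransform, integral_dual_apply this]
  · simp

/-- By inversion `σ` is a combination of the evaluations at elements of `H`, and these are
orthogonal to evaluation at `g ∉ H`. -/
theorem FactorsThroughRestrict.fourierTransform_eq_zero {σ : PontryaginDual G → ℂ}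
    [Finite H] (hσ : FactorsThroughRestrict H σ) (hc : Continuous σ) {g : G} (hg : g ∉ H) :
    fourierTransform σ g = 0 := by
  have := Fintype.ofFinite H
  have h1 : fourierTransform σ g = ∫ χ : PontryaginDual G, ∑ h : H,
      fourierTransform σ (h : G) * conj ((χ ((h : G)⁻¹ * g) : Circle) : ℂ) ∂(dualHaar G) := by
    rw [fourierTransform]
    refine integral_congr_ae (Filter.Eventually.of_forall fun χ => ?_)
    simp only
    rw [← hσ.inversion hc χ, Finset.sum_mul]
    refine Finset.sum_congr rfl fun h _ => ?_
    rw [map_mul, map_inv, Circle.coe_mul, Circle.coe_inv_eq_conj, map_mul, Complex.conj_conj,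
      mul_assoc]
  rw [h1, integral_finsetSum]
  · refine Finset.sum_eq_zero fun h _ => ?_
    rw [integral_const_mul, integral_dual_apply, mul_zero]
    intro h2
    exact hg (by rw [← inv_mul_eq_one.1 h2]; exact h.2)
  · intro h _
    exact integrable_of_continuous_dual _ (continuous_const.mul
      (Complex.continuous_conj.comp (continuous_dual_apply_coe _)))

theorem FactorsThroughRestrict.finite_support {σ : PontryaginDual G → ℂ} [Finite H]
    (hσ : FactorsThroughRestrict H σ) (hc : Continuous σ) :
    (Function.support (fourierTransform σ)).Finite :=
  (Set.toFinite (H : Set G)).subset fun g hg => by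
    by_contra h
    exact hg (hσ.fourierTransform_eq_zero hc h)

/-- Convolution with a Fourier transform, as a sum over the subgroup that supports it. -/
theorem FactorsThroughRestrict.convolve_eq_sum {σ : PontryaginDual G → ℂ} [Fintype H]
    (hσ : FactorsThroughRestrict H σ) (hc : Continuous σ) (x : G → ℂ) (g : G) :
    convolve (fourierTransform σ) x g =
      ∑ h : H, fourierTransform σ (h : G) * x ((h : G)⁻¹ * g) := by
  rw [convolve, ← tsum_fintype (L := .unconditional _)]
  refine (tsum_subtype_eq_of_support_subset (s := (H : Set G)) fun g hg => ?_).symm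
  by_contra h
  exact hg (by simp [hσ.fourierTransform_eq_zero hc h])

/-- The convolution theorem for the Fourier–Stieltjes transform of a measure with continuous
density. -/
theorem FactorsThroughRestrict.convolve_integral {σ f : PontryaginDual G → ℂ} [Finite H]
    (hσ : FactorsThroughRestrict H σ) (hc : Continuous σ) (hf : Continuous f)
    (ν : Measure (PontryaginDual G)) [IsFiniteMeasure ν] (g : G) :
    convolve (fourierTransform σ) (fun k => ∫ χ, f χ * conj ((χ k : Circle) : ℂ) ∂ν) g =
      ∫ χ, σ χ * f χ * conj ((χ g : Circle) : ℂ) ∂ν := by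
  have := Fintype.ofFinite H
  rw [hσ.convolve_eq_sum hc]
  simp_rw [← integral_const_mul]
  rw [← integral_finsetSum]
  · refine integral_congr_ae (Filter.Eventually.of_forall fun χ => ?_)
    simp only
    rw [← hσ.inversion hc χ, Finset.sum_mul, Finset.sum_mul]
    refine Finset.sum_congr rfl fun h _ => ?_
    rw [map_mul, map_inv, Circle.coe_mul, Circle.coe_inv_eq_conj, map_mul, Complex.conj_conj]
    ring
  · intro h _
    exact integrable_of_continuous_dual _ (continuous_const.mul (hf.mul
      (Complex.continuous_conj.comp (continuous_dual_apply_coe _))))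

/-- Parseval's identity for indicator functions that factor through a finite subgroup. -/
theorem FactorsThroughRestrict.sum_norm_sq {U : Set (PontryaginDual G)} [Fintype H]
    (hU : IsClopen U) (hσ : FactorsThroughRestrict H (U.indicator 1)) :
    ∑ h : H, ‖fourierTransform (U.indicator (1 : PontryaginDual G → ℂ)) (h : G)‖ ^ 2 =
      (dualHaar G).real U := by
  have hc : Continuous (U.indicator (1 : PontryaginDual G → ℂ)) :=
    continuous_one.indicator (by simp [hU.frontier_eq])
  have hsq : ∀ χ, U.indicator (1 : PontryaginDual G → ℂ) χ * U.indicator 1 χ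
      = U.indicator 1 χ := fun χ => by by_cases h : χ ∈ U <;> simp [h]
  -- Parseval is the identity `1_U * 1_U = 1_U` on the transform side, evaluated at `g = 1`.
  have h1 := hσ.convolve_integral hc hc (dualHaar G) 1
  rw [hσ.convolve_eq_sum hc] at h1
  simp only [hsq, map_one, Circle.coe_one, mul_one] at h1
  have h3 : ∫ χ, U.indicator (1 : PontryaginDual G → ℂ) χ ∂(dualHaar G) =
      ((dualHaar G).real U : ℂ) := by
    rw [integral_indicator hU.isOpen.measurableSet]
    simp
  rw [h3] at h1
  have h2 : ∀ g : G, (∫ χ, U.indicator (1 : PontryaginDual G → ℂ) χ *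
      conj ((χ g⁻¹ : Circle) : ℂ) ∂(dualHaar G)) =
        conj (fourierTransform (U.indicator (1 : PontryaginDual G → ℂ)) g) := by
    intro g
    rw [fourierTransform, ← integral_conj]
    refine integral_congr_ae (Filter.Eventually.of_forall fun χ => ?_)
    by_cases h : χ ∈ U <;> simp [h, ← Circle.coe_inv_eq_conj]
  simp only [h2, Complex.mul_conj'] at h1
  exact_mod_cast h1

theorem norm_fourierTransform_indicator_le_one {U : Set (PontryaginDual G)} (g : G) :
    ‖fourierTransform (U.indicator (1 : PontryaginDual G → ℂ)) g‖ ≤ 1 := by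
  refine (norm_integral_le_of_norm_le_const (C := 1)
    (Filter.Eventually.of_forall fun χ => ?_)).trans (by simp)
  by_cases h : χ ∈ U <;> simp [h, Circle.norm_coe]

end Fourier
-- Translation and convolution operators on `ℓ^p G`.
/-- A closed subspace of `ℓ^p`, `p < ∞`, that contains all point masses is everything. -/
theorem eq_top_of_single_mem {ι : Type*} [DecidableEq ι] {p : ℝ≥0∞} [Fact (1 ≤ p)] (hp : p ≠ ∞) {E : Submodule ℂ (EllP ι p)}
    (hE : IsClosed (E : Set (EllP ι p)))
    (h : ∀ g c, lp.single p g c ∈ E) : E = ⊤ := by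
  refine eq_top_iff.2 fun f _ => ?_
  refine hE.mem_of_tendsto (lp.hasSum_single hp f) (Filter.Eventually.of_forall fun s => ?_)
  exact E.sum_mem fun g _ => h g _

section Operators

variable {G : Type*} [Group G] {p : ℝ≥0∞}

theorem translate_apply (g : G) (f : EllP G p) (h : G) : translate g f h = f (g⁻¹ * h) := rfl

theorem translate_single [DecidableEq G] (g h : G) (c : ℂ) :
    translate g (lp.single p h c : EllP G p) = lp.single p (g * h) c := by
  refine lp.ext (funext fun k => ?_)
  rw [translate_apply, lp.coeFn_single, lp.coeFn_single, Pi.single_apply, Pi.single_apply]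
  simp only [inv_mul_eq_iff_eq_mul]

theorem convolve_single_one [DecidableEq G] (S : G → ℂ) :
    convolve S (lp.single p 1 1 : EllP G p) = S := by
  funext g
  rw [convolve, tsum_eq_single g]
  · simp
  · intro h hh
    rw [lp.coeFn_single, Pi.single_eq_of_ne, mul_zero]
    exact fun h' => hh (inv_mul_eq_one.1 h')

variable [Fact (1 ≤ p)]

theorem norm_translate (hp : p ≠ ∞) (g : G) (f : EllP G p) : ‖translate g f‖ = ‖f‖ := by
  have hp0 : 0 < p.toReal := ENNReal.toReal_pos (zero_lt_one.trans_le Fact.out).ne' hp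
  rw [lp.norm_eq_tsum_rpow hp0, lp.norm_eq_tsum_rpow hp0]
  congr 1
  exact (Equiv.mulLeft g⁻¹).tsum_eq fun h => ‖f h‖ ^ p.toReal

/-- Translation as a continuous linear operator. -/
noncomputable def translateCLM (hp : p ≠ ∞) (g : G) : EllP G p →L[ℂ] EllP G p :=
  LinearMap.mkContinuous
    { toFun := translate g
      map_add' := fun _ _ => rfl
      map_smul' := fun _ _ => rfl } 1 fun f => by
      rw [one_mul]; exact (norm_translate hp g f).le

theorem translateCLM_apply (hp : p ≠ ∞) (g : G) (f : EllP G p) :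
    translateCLM hp g f = translate g f := rfl

/-- Convolution with a finitely supported function as a continuous linear operator. -/
noncomputable def convolveCLM (hp : p ≠ ∞) {S : G → ℂ} (hS : S.support.Finite) :
    EllP G p →L[ℂ] EllP G p :=
  ∑ h ∈ hS.toFinset, S h • translateCLM hp h

theorem coe_convolveCLM (hp : p ≠ ∞) {S : G → ℂ} (hS : S.support.Finite) (x : EllP G p) :
    (convolveCLM hp hS x : G → ℂ) = convolve S x := by
  funext g
  rw [convolve, tsum_eq_sum (s := hS.toFinset)]
  · simp only [convolveCLM, FunLike.coe_sum, FunLike.coe_smul, Finset.sum_apply, Pi.smul_apply,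
      lp.coeFn_sum, lp.coeFn_smul, translateCLM_apply, translate_apply, smul_eq_mul]
  · intro h hh
    have : S h = 0 := by simpa using hh
    simp [this]

/-- The vectors on which two continuous translation-equivariant operators agree form a closed
invariant subspace. -/
theorem isClosedInvariant_eqLocus {A B : EllP G p →L[ℂ] EllP G p}
    (hA : ∀ g x, A (translate g x) = translate g (A x))
    (hB : ∀ g x, B (translate g x) = translate g (B x)) :
    IsClosedInvariant (LinearMap.eqLocus (A : EllP G p →ₗ[ℂ] EllP G p) B) where
  isClosed := isClosed_eq A.continuous B.continuous
  invariant g f hf := by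
    have hf' : A f = B f := hf
    change A _ = B _
    rw [hA, hB, hf']

theorem closedInvariantSpan_le {E : Submodule ℂ (EllP G p)} (hE : IsClosedInvariant E)
    {f : EllP G p} (hf : f ∈ E) : closedInvariantSpan f ≤ E :=
  sInf_le ⟨hE, hf⟩

end Operators

section Commutative

variable {G : Type*} [CommGroup G] {p : ℝ≥0∞} [Fact (1 ≤ p)]

theorem convolveCLM_translate (hp : p ≠ ∞) {S : G → ℂ} (hS : S.support.Finite) (g : G)
    (x : EllP G p) :
    convolveCLM hp hS (translate g x) = translate g (convolveCLM hp hS x) := by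
  refine lp.ext (funext fun k => ?_)
  rw [translate_apply, coe_convolveCLM, coe_convolveCLM]
  simp only [convolve, translate_apply, mul_left_comm]

/-- A translation-equivariant continuous operator is determined by its value at the point mass
at `1`. -/
theorem clm_eq_of_apply_single_one [DecidableEq G] (hp : p ≠ ∞) {A B : EllP G p →L[ℂ] EllP G p}
    (hA : ∀ g x, A (translate g x) = translate g (A x))
    (hB : ∀ g x, B (translate g x) = translate g (B x))
    (h : A (lp.single p 1 1) = B (lp.single p 1 1)) : A = B := by
  have hE := isClosedInvariant_eqLocus hA hB
  -- Invariance of the agreement space carries `δ₁` to every point mass.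
  have htop := eq_top_of_single_mem hp hE.isClosed fun g c => by
    have h1 := Submodule.smul_mem _ c (hE.invariant g _ h)
    rwa [translate_single, ← lp.single_smul, smul_eq_mul, mul_one, mul_one] at h1
  refine ContinuousLinearMap.ext fun x => ?_
  have hx : x ∈ (⊤ : Submodule ℂ (EllP G p)) := trivial
  rwa [← htop] at hx

end Commutative

/-! ### Norm comparison, and exhaustion by finite subgroups. -/

/-- The `p`-th power of the `ℓ^p` norm is at most the square sum if all values have modulus at most
one and `p ≥ 2`. -/
theorem norm_rpow_le_sum_sq {ι : Type*} {p : ℝ≥0∞} (hp : 2 ≤ p) (hp' : p ≠ ∞)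
    (f : lp (fun _ : ι => ℂ) p) (s : Finset ι) (hs : ∀ i ∉ s, f i = 0) (h1 : ∀ i, ‖f i‖ ≤ 1) :
    ‖f‖ ^ p.toReal ≤ ∑ i ∈ s, ‖f i‖ ^ 2 := by
  have h2 : 2 ≤ p.toReal := by
    simpa using ENNReal.toReal_mono hp' hp
  have hp0 : 0 < p.toReal := by linarith
  rw [lp.norm_rpow_eq_tsum hp0, tsum_eq_sum (s := s)]
  · refine Finset.sum_le_sum fun i _ => ?_
    rw [← Real.rpow_natCast]
    exact Real.rpow_le_rpow_of_exponent_ge' (norm_nonneg _) (h1 i) (by norm_num) (by simpa using h2)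
  · intro i hi
    rw [hs i hi, norm_zero, Real.zero_rpow hp0.ne']

theorem exists_monotone_finite_subgroups {G : Type*} [Group G] [Countable G]
    (hG : LocallyFiniteGroup G) :
    ∃ H : ℕ → Subgroup G, Monotone H ∧ (∀ n, Finite (H n)) ∧ ∀ g, ∃ n, g ∈ H n := by
  obtain ⟨e, he⟩ := exists_surjective_nat G
  refine ⟨fun n => Subgroup.closure (e '' Set.Iic n), fun m n hmn => ?_, fun n => ?_, fun g => ?_⟩
  · exact Subgroup.closure_mono (Set.image_mono (Set.Iic_subset_Iic.2 hmn))
  · exact hG _ ((Subgroup.fg_iff _).2 ⟨_, rfl, (Set.finite_Iic n).image e⟩)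
  · obtain ⟨n, rfl⟩ := he g
    exact ⟨n, Subgroup.subset_closure ⟨n, le_refl n, rfl⟩⟩

/-! ### Clopen neighbourhoods of a closed set of characters and their cutoffs. -/

section Saturation

variable {G : Type*} [CommGroup G] [TopologicalSpace G]

/-- The characters that agree on `H` with a character in `K`. -/
def saturation (H : Subgroup G) (K : Set (PontryaginDual G)) : Set (PontryaginDual G) :=
  {χ | ∃ κ ∈ K, ∀ h ∈ H, χ h = κ h}

theorem subset_saturation (H : Subgroup G) (K : Set (PontryaginDual G)) : K ⊆ saturation H K :=
  fun κ hκ => ⟨κ, hκ, fun _ _ => rfl⟩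

theorem saturation_anti {H H' : Subgroup G} (h : H ≤ H') (K : Set (PontryaginDual G)) :
    saturation H' K ⊆ saturation H K :=
  fun _ ⟨κ, hκ, hχ⟩ => ⟨κ, hκ, fun g hg => hχ g (h hg)⟩

theorem factorsThroughRestrict_indicator_saturation (H : Subgroup G)
    (K : Set (PontryaginDual G)) :
    FactorsThroughRestrict H ((saturation H K).indicator 1) := by
  intro χ ψ h
  have : χ ∈ saturation H K ↔ ψ ∈ saturation H K :=
    ⟨fun ⟨κ, hκ, hχ⟩ => ⟨κ, hκ, fun g hg => (h g hg).symm.trans (hχ g hg)⟩,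
      fun ⟨κ, hκ, hψ⟩ => ⟨κ, hκ, fun g hg => (h g hg).trans (hψ g hg)⟩⟩
  by_cases hχ : χ ∈ saturation H K
  · rw [Set.indicator_of_mem hχ, Set.indicator_of_mem (this.1 hχ)]; rfl
  · rw [Set.indicator_of_notMem hχ, Set.indicator_of_notMem (mt this.2 hχ)]

/-- Yields clopenness, restriction to a finite subgroup being locally constant. -/
theorem saturation_eq_preimage (H : Subgroup G) [Finite H] (K : Set (PontryaginDual G)) :
    saturation H K = dualRestrict H ⁻¹' (dualRestrict H '' K) := by
  ext χ
  constructor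
  · rintro ⟨κ, hκ, h⟩
    exact ⟨κ, hκ, funext fun g => (h g g.2).symm⟩
  · rintro ⟨κ, hκ, h⟩
    exact ⟨κ, hκ, fun g hg => (congrFun h ⟨g, hg⟩).symm⟩

theorem isClopen_saturation (H : Subgroup G) [Finite H] (K : Set (PontryaginDual G)) :
    IsClopen (saturation H K) := by
  rw [saturation_eq_preimage]
  exact ⟨⟨by rw [← Set.preimage_compl]; exact (dualRestrict H).isLocallyConstant _⟩,
    (dualRestrict H).isLocallyConstant _⟩

/-- The indicator function of the complement of the saturation of `K`. -/
noncomputable def cutoff (H : Subgroup G) [Finite H] (K : Set (PontryaginDual G)) :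
    LocallyConstant (PontryaginDual G) ℂ :=
  1 - LocallyConstant.charFn ℂ (isClopen_saturation H K)

variable {H : Subgroup G} [Finite H] {K : Set (PontryaginDual G)}

theorem cutoff_apply (χ : PontryaginDual G) :
    cutoff H K χ = 1 - (saturation H K).indicator 1 χ := rfl

theorem cutoff_of_mem {χ : PontryaginDual G} (h : χ ∈ saturation H K) : cutoff H K χ = 0 := by
  simp [cutoff_apply, h]

theorem cutoff_of_notMem {χ : PontryaginDual G} (h : χ ∉ saturation H K) :
    cutoff H K χ = 1 := by
  simp [cutoff_apply, h]

theorem factorsThroughRestrict_cutoff : FactorsThroughRestrict H (cutoff H K) :=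
  fun χ ψ h => by
    rw [cutoff_apply, cutoff_apply, factorsThroughRestrict_indicator_saturation H K χ ψ h]

theorem continuous_indicator_saturation :
    Continuous ((saturation H K).indicator (1 : PontryaginDual G → ℂ)) :=
  continuous_one.indicator (by simp [(isClopen_saturation H K).frontier_eq])

variable [DiscreteTopology G]

/-- The saturations of a closed set with respect to an exhausting sequence of subgroups
shrink to the set. -/
theorem eventually_notMem_saturation {H : ℕ → Subgroup G} (hH : Monotone H)
    (hH' : ∀ g, ∃ n, g ∈ H n) (hK : IsClosed K)
    {χ : PontryaginDual G} (hχ : χ ∉ K) : ∀ᶠ n in Filter.atTop, χ ∉ saturation (H n) K := by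
  -- The witnesses for `χ ∈ saturation (H n) K` form nested compact sets; a common witness would
  -- equal `χ` on all of `G`, so some `t n` is empty.
  let t : ℕ → Set (PontryaginDual G) := fun n => {κ | κ ∈ K ∧ ∀ h ∈ H n, χ h = κ h}
  have hclosed : ∀ n, IsClosed (t n) := fun n => by
    have : t n = K ∩ ⋂ h ∈ H n, {κ : PontryaginDual G | χ h = κ h} := by
      ext κ; simp [t]
    rw [this]
    exact hK.inter (isClosed_biInter fun h _ =>
      isClosed_eq continuous_const (continuous_dual_apply h))
  have hanti : ∀ m n, m ≤ n → t n ⊆ t m := fun m n hmn κ hκ =>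
    ⟨hκ.1, fun g hg => hκ.2 g (hH hmn hg)⟩
  have hempty : ∃ n, t n = ∅ := by
    by_contra! hne
    obtain ⟨κ, hκ⟩ := IsCompact.nonempty_iInter_of_sequence_nonempty_isCompact_isClosed t
      (fun n => hanti n (n + 1) n.le_succ) hne (hclosed 0).isCompact hclosed
    rw [Set.mem_iInter] at hκ
    refine hχ ?_
    have : χ = κ := PontryaginDual.ext fun g => by
      obtain ⟨n, hn⟩ := hH' g
      exact (hκ n).2 g hn
    rw [this]
    exact (hκ 0).1
  obtain ⟨n, hn⟩ := hempty
  filter_upwards [Filter.eventually_ge_atTop n] with m hm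
  rintro ⟨κ, hκ, h⟩
  have : κ ∈ t n := hanti n m hm ⟨hκ, h⟩
  rw [hn] at this
  exact this

variable [MeasurableSpace (PontryaginDual G)] [BorelSpace (PontryaginDual G)]

theorem tendsto_measure_saturation {H : ℕ → Subgroup G} [∀ n, Finite (H n)] (hH : Monotone H)
    (hH' : ∀ g, ∃ n, g ∈ H n) (hK : IsClosed K) (ν : Measure (PontryaginDual G))
    [IsFiniteMeasure ν] :
    Filter.Tendsto (fun n => ν (saturation (H n) K)) Filter.atTop (𝓝 (ν K)) := by
  have hI : ⋂ n, saturation (H n) K = K := by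
    refine Set.Subset.antisymm (fun χ hχ => ?_)
      (Set.subset_iInter fun n => subset_saturation (H n) K)
    by_contra h
    obtain ⟨n, hn⟩ := (eventually_notMem_saturation hH hH' hK h).exists
    exact hn (Set.mem_iInter.1 hχ n)
  conv in ν K => rw [← hI]
  exact tendsto_measure_iInter_atTop
    (fun n => (isClopen_saturation (H n) K).isOpen.measurableSet.nullMeasurableSet)
    (fun m n h => saturation_anti (hH h) K) ⟨0, measure_ne_top _ _⟩

/-- The constant `1` transforms to the point mass at `1`, by orthogonality. -/
theorem fourierTransform_cutoff [DecidableEq G] (g : G) :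
    fourierTransform (cutoff H K) g = (Pi.single 1 1 : G → ℂ) g -
      fourierTransform ((saturation H K).indicator (1 : PontryaginDual G → ℂ)) g := by
  have hone : (Pi.single 1 1 : G → ℂ) g = ∫ χ, conj ((χ g : Circle) : ℂ) ∂(dualHaar G) := by
    by_cases hg : g = 1
    · subst hg; simp
    · rw [integral_dual_apply hg, Pi.single_eq_of_ne hg]
  rw [hone, fourierTransform, fourierTransform, ← integral_sub]
  · simp only [cutoff_apply, sub_mul, one_mul]
  · exact integrable_of_continuous_dual _
      (Complex.continuous_conj.comp (continuous_dual_apply_coe _))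
  · exact integrable_of_continuous_dual _ (continuous_indicator_saturation.mul
      (Complex.continuous_conj.comp (continuous_dual_apply_coe _)))

theorem finite_support_fourierTransform_cutoff :
    (fourierTransform (cutoff H K)).support.Finite :=
  (factorsThroughRestrict_cutoff (H := H) (K := K)).finite_support
    (LocallyConstant.continuous _)

/-- Convolution with the transform of the cutoff of a smaller saturation fixes the transform of the
cutoff of a larger one. -/
theorem convolve_fourierTransform_cutoff {H' : Subgroup G} [Finite H'] (h : H ≤ H') :
    convolve (fourierTransform (cutoff H' K)) (fourierTransform (cutoff H K)) =
      fourierTransform (cutoff H K) := by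
  funext g
  refine ((factorsThroughRestrict_cutoff (H := H') (K := K)).convolve_integral
    (LocallyConstant.continuous _) (cutoff H K).continuous (dualHaar G) g).trans ?_
  refine integral_congr_ae (Filter.Eventually.of_forall fun χ => ?_)
  simp only
  by_cases hχ : χ ∈ saturation H K
  · rw [cutoff_of_mem hχ, mul_zero]
  · rw [cutoff_of_notMem (fun h' => hχ (saturation_anti h K h')), one_mul]

/-- The cutoffs associated with the support of a measure annihilate its Fourier–Stieltjes
transform. -/
theorem convolve_fourierTransform_cutoff_support (μ : Measure (PontryaginDual G))
    [IsFiniteMeasure μ] :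
    convolve (fourierTransform (cutoff H μ.support)) (fourierStieltjes μ) = 0 := by
  have hμ : fourierStieltjes μ = fun g : G =>
      ∫ χ : PontryaginDual G, (1 : ℂ) * conj ((χ g : Circle) : ℂ) ∂μ := by
    funext g; simp only [one_mul, fourierStieltjes]
  rw [hμ]
  funext g
  rw [(factorsThroughRestrict_cutoff (H := H) (K := μ.support)).convolve_integral
    (LocallyConstant.continuous _) continuous_const μ g]
  -- A compact set disjoint from the support is null, so no regularity of `μ` is needed.
  have h0 : μ (saturation H μ.support)ᶜ = 0 :=
    Measure.measure_eq_zero_of_isCompact_subset_compl_support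
      (isClopen_saturation H _).isOpen.isClosed_compl.isCompact
      (Set.compl_subset_compl.2 (subset_saturation H _))
  refine integral_eq_zero_of_ae ?_
  filter_upwards [measure_eq_zero_iff_ae_notMem.1 h0] with χ hχ
  rw [cutoff_of_mem (not_not.1 hχ)]
  simp

/-! ### Approximation of point masses in `ℓ^p`. -/

variable {p : ℝ≥0∞} [Fact (1 ≤ p)]

theorem norm_single_sub_convolveCLM_le [DecidableEq G] (hp : 2 ≤ p) (hp' : p ≠ ∞) :
    ‖(lp.single p 1 1 : EllP G p) - convolveCLM hp'
      (finite_support_fourierTransform_cutoff (H := H) (K := K)) (lp.single p 1 1)‖ ^ p.toReal ≤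
      (dualHaar G).real (saturation H K) := by
  have := Fintype.ofFinite H
  have hσ := factorsThroughRestrict_indicator_saturation H K
  have hval : ∀ g : G, ((lp.single p 1 1 : EllP G p) - convolveCLM hp'
      (finite_support_fourierTransform_cutoff (H := H) (K := K)) (lp.single p 1 1) : EllP G p) g =
      fourierTransform ((saturation H K).indicator (1 : PontryaginDual G → ℂ)) g := by
    intro g
    rw [lp.coeFn_sub, Pi.sub_apply, coe_convolveCLM, convolve_single_one, fourierTransform_cutoff,
      lp.coeFn_single, sub_sub_cancel]
  rw [← hσ.sum_norm_sq (isClopen_saturation H K)]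
  simp only [← hval]
  refine le_of_le_of_eq ?_ (Finset.sum_map Finset.univ (Function.Embedding.subtype (· ∈ H))
    fun g => ‖((lp.single p 1 1 : EllP G p) - convolveCLM hp'
      (finite_support_fourierTransform_cutoff (H := H) (K := K)) (lp.single p 1 1) :
        EllP G p) g‖ ^ 2)
  refine norm_rpow_le_sum_sq hp hp' _ _ (fun g hg => ?_) fun g => ?_
  · rw [hval]
    exact hσ.fourierTransform_eq_zero continuous_indicator_saturation (by simpa using hg)
  · rw [hval]
    exact norm_fourierTransform_indicator_le_one g

/-- Convolution with the transforms of the cutoffs of a closed null set approximates the identity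
at every point mass. -/
theorem tendsto_convolveCLM_single [DecidableEq G] (hp : 2 ≤ p) (hp' : p ≠ ∞) {H : ℕ → Subgroup G}
    [∀ n, Finite (H n)] (hH : Monotone H) (hH' : ∀ g, ∃ n, g ∈ H n) (hK : IsClosed K)
    (hK0 : dualHaar G K = 0) (g : G) (c : ℂ) :
    Filter.Tendsto (fun n => convolveCLM hp'
      (finite_support_fourierTransform_cutoff (H := H n) (K := K)) (lp.single p g c : EllP G p))
      Filter.atTop (𝓝 (lp.single p g c)) := by
  have hp0 : 0 < p.toReal := ENNReal.toReal_pos (zero_lt_one.trans_le Fact.out).ne' hp'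
  have hone : Filter.Tendsto (fun n => convolveCLM hp'
      (finite_support_fourierTransform_cutoff (H := H n) (K := K)) (lp.single p 1 1 : EllP G p))
      Filter.atTop (𝓝 (lp.single p 1 1)) := by
    rw [tendsto_iff_norm_sub_tendsto_zero]
    have hm : Filter.Tendsto (fun n => (dualHaar G).real (saturation (H n) K) ^ p.toReal⁻¹)
        Filter.atTop (𝓝 0) := by
      have h1 := (ENNReal.tendsto_toReal (measure_ne_top (dualHaar G) K)).comp
        (tendsto_measure_saturation hH hH' hK (dualHaar G))
      have h2 := h1.rpow_const (p := p.toReal⁻¹) (Or.inr (inv_nonneg.2 hp0.le))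
      rwa [hK0, ENNReal.toReal_zero, Real.zero_rpow (inv_ne_zero hp0.ne')] at h2
    refine squeeze_zero (fun n => norm_nonneg _) (fun n => ?_) hm
    rw [norm_sub_rev]
    exact (Real.le_rpow_inv_iff_of_pos (norm_nonneg _) measureReal_nonneg hp0).2
      (norm_single_sub_convolveCLM_le hp hp')
  -- Any point mass is a multiple of a translate of `δ₁`, and convolution commutes with both
  -- operations.
  have h := ((c • translateCLM hp' g).continuous.tendsto _).comp hone
  simpa only [Function.comp_def, FunLike.coe_smul, Pi.smul_apply, translateCLM_apply,
    ← convolveCLM_translate, ← map_smul, translate_single, ← lp.single_smul, smul_eq_mul,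
    mul_one] using h

end Saturation

end LpExhaustion

/-! ### The exhaustion by fixed spaces. -/

open LpExhaustion in
theorem mainTheorem4 {G : Type*} [CommGroup G] [Countable G] [Infinite G]
    (hG : LpExhaustion.LocallyFiniteGroup G)
    [TopologicalSpace G] [DiscreteTopology G]
    [MeasurableSpace (PontryaginDual G)] [BorelSpace (PontryaginDual G)]
    (p : ℝ≥0∞) [Fact (1 ≤ p)] (hp : 2 < p) (hp' : p < ∞)
    (μ : MeasureTheory.Measure (PontryaginDual G)) [MeasureTheory.IsFiniteMeasure μ]
    (hsupp : LpExhaustion.dualHaar G μ.support = 0)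
    (hμ : Memℓp (LpExhaustion.fourierStieltjes μ) p) :
    ∃ E : ℕ → Submodule ℂ (LpExhaustion.EllP G p),
      LpExhaustion.IsInvariantExhaustion E ∧
      (∀ i, LpExhaustion.closedInvariantSpan
        (⟨LpExhaustion.fourierStieltjes μ, hμ⟩ : LpExhaustion.EllP G p) ⊓ E i = ⊥) ∧
      ∃ σ : ℕ → LocallyConstant (PontryaginDual G) ℂ,
        (∀ i, ∀ᶠ χ in 𝓝ˢ μ.support, σ i χ = 0) ∧
        (∀ χ ∉ μ.support, ∀ᶠ i in Filter.atTop, σ i χ = 1) ∧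
        (∀ i, (Function.support (LpExhaustion.fourierTransform (σ i))).Finite) ∧
        (∀ i, ∀ x : LpExhaustion.EllP G p,
          x ∈ E i ↔ LpExhaustion.convolve (LpExhaustion.fourierTransform (σ i)) x = x) := by
  classical
  obtain ⟨H, hH, hfin, hH'⟩ := exists_monotone_finite_subgroups hG
  have hK : IsClosed μ.support := MeasureTheory.Measure.isClosed_support
  let C : ℕ → EllP G p →L[ℂ] EllP G p := fun n =>
    convolveCLM hp'.ne (finite_support_fourierTransform_cutoff (H := H n) (K := μ.support))
  have hC : ∀ n g x, C n (translate g x) = translate g (C n x) := fun n =>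
    convolveCLM_translate hp'.ne _
  have hCC : ∀ m n, m ≤ n → ∀ x, C n (C m x) = C m x := fun m n hmn => by
    refine DFunLike.congr_fun (f := (C n).comp (C m)) (clm_eq_of_apply_single_one hp'.ne
      (fun g x => by simp only [ContinuousLinearMap.comp_apply, hC]) (hC m) (lp.ext ?_))
    rw [ContinuousLinearMap.comp_apply, coe_convolveCLM, coe_convolveCLM, convolve_single_one]
    exact convolve_fourierTransform_cutoff (hH hmn)
  let E : ℕ → Submodule ℂ (EllP G p) := fun n => LinearMap.eqLocus
    (C n : EllP G p →ₗ[ℂ] EllP G p) (ContinuousLinearMap.id ℂ (EllP G p))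
  have hE : ∀ n x, x ∈ E n ↔ C n x = x := fun n x => Iff.rfl
  have hEinv : ∀ n, IsClosedInvariant (E n) := fun n =>
    isClosedInvariant_eqLocus (hC n) fun _ _ => rfl
  have hmono : Monotone E := fun m n hmn x hx => by
    rw [hE] at hx ⊢
    rw [← hx, hCC m n hmn]
  refine ⟨E, ⟨hEinv, hmono, ?_⟩, fun n => ?_, fun n => cutoff (H n) μ.support, fun n => ?_,
    fun χ hχ => ?_, fun n => finite_support_fourierTransform_cutoff, fun n x => ?_⟩
  · rw [← Submodule.coe_iSup_of_directed E hmono.directed_le,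
      Submodule.dense_iff_topologicalClosure_eq_top]
    refine eq_top_of_single_mem hp'.ne (Submodule.isClosed_topologicalClosure _) fun g c => ?_
    refine mem_closure_of_tendsto
      (tendsto_convolveCLM_single hp.le hp'.ne hH hH' hK hsupp g c)
      (Filter.Eventually.of_forall fun n => ?_)
    -- The case `m = n` of `hCC` is idempotence, which puts the approximants in `E n`.
    exact Submodule.mem_iSup_of_mem n ((hE n _).2 (hCC n n le_rfl _))
  -- With `B = 0` the agreement space is the kernel of `C n`, which thus contains `F`.
  · have hF := closedInvariantSpan_le (f := (⟨fourierStieltjes μ, hμ⟩ : EllP G p))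
      (isClosedInvariant_eqLocus (hC n) (B := 0) fun _ _ => rfl)
      (lp.ext ((coe_convolveCLM _ _ _).trans (convolve_fourierTransform_cutoff_support μ)))
    refine (Submodule.eq_bot_iff _).2 fun x hx => ?_
    rw [← (hE n x).1 hx.2]
    exact hF hx.1
  · exact Filter.mem_of_superset ((isClopen_saturation (H n) _).isOpen.mem_nhdsSet.2
      (subset_saturation _ _)) fun χ hχ => cutoff_of_mem hχ
  · filter_upwards [eventually_notMem_saturation hH hH' hK hχ] with n hn
    exact cutoff_of_notMem hn
  · rw [hE, ← coe_convolveCLM hp'.ne finite_support_fourierTransform_cutoff]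
    exact lp.ext_iff
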